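/- Let $\mathcal U=\mathcal U_{n,m}^r$ be a uni-cyclic multigraph: a finite connected loopless multigraph with $n$ edges (parallel edges counted individually) whose associated simple graph has exactly one cycle, this cycle having length $m$ (so $m\ge 3$), and in which exactly $r$ pairs of vertices are joined by at least two edges; such a pair, with the edges joining it, is called a multiple edge. Let $r'$ of the multiple edges lie on the cycle and $r''$ outside the cycle ($r=r'+r''$). Index the multiple edges on the cycle by $1,\dots,r'$ and those outside by $m+1,\dots,m+r''$, let $t_k\ge 2$ be the number of parallel edges in the $k$-th multiple edge, and put $\alpha=\sum_{k=1}^{r'}t_k$ and $\beta=\sum_{k=m+1}^{m+r''}t_k$. Let $\Delta_s(\mathcal U)$ be the spanning simplicial complex of $\mathcal U$, i.e. the simplicial complex on the edges of $\mathcal U$ generated by the edge sets of the spanning trees of $\mathcal U$; let $f_i$ be the number of its faces with $i+1$ elements, let its dimension be $\max_F(|F|-1)$ over its faces $F$, and let $\chi(\Delta)=\sum_{i=0}^{\dim\Delta}(-1)^if_i$. Binomial coefficients $\binom{a}{b}$ with $b<0$ are $0$. Then $$\dim\Delta_s(\mathcal U)=n-\alpha-\beta+r-2,$$ for every integer $i\ge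 0$ $$\begin{aligned}f_i={}&\binom{n}{i+1}-\prod_{k=1}^{r'}t_k\Bigg[\binom{n-\alpha+r'-m}{i+1-m}\\&\qquad-\sum_{j=2}^{\beta}\Big(\binom{\beta}{j}-\sum_{\substack{S\subseteq\{m+1,\dots,m+r''\}\\|S|=j}}\ \prod_{k\in S}t_k\Big)\sum_{l=j}^{\beta}(-1)^{l-j}\binom{\beta-j}{l-j}\binom{n-\alpha+r'-m-l}{i+1-m-l}\Bigg]\\&-\sum_{j=2}^{\alpha+\beta}\Big(\binom{\alpha+\beta}{j}-\sum_{\substack{S\subseteq\{1,\dots,r'\}\cup\{m+1,\dots,m+r''\}\\|S|=j}}\ \prod_{k\in S}t_k\Big)\sum_{l=j}^{\alpha+\beta}(-1)^{l-j}\binom{\alpha+\beta-j}{l-j}\binom{n-l}{i+1-l},\end{aligned}$$ and $$\chi(\Delta_s(\mathcal U))=\sum_{i=0}^{n-1}(-1)^if_i$$ with each $f_i$ given by this expression. -/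

import Mathlib

namespace Graph

variable {V ε : Type*}

/-- A multigraph is a tree if it is connected and has no cycle. A loop is a cycle of length one and
two parallel edges form a cycle of length two, so a tree is a simple multigraph (no loops, no
parallel edges) whose associated simple graph, on the same vertices, is a tree. -/
def IsTree (T : Graph V ε) : Prop := T.Simple ∧ T.toSimpleGraph.IsTree

/-- `T` is a spanning tree of `G`: a subgraph of `G` that is a tree and contains every vertex. -/
def IsSpanningTree (T G : Graph V ε) : Prop := T.IsSpanningSubgraph G ∧ T.IsTree

/-- The spanning simplicial complex of `G`: the simplicial complex on the edges of `G` generated by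
the edge sets of the spanning trees of `G`. (Mathlib's convention is not to list the empty face.) -/
def spanningComplex (G : Graph V ε) : PreAbstractSimplicialComplex ε where
  faces := {F | F.Nonempty ∧ ∃ T : Graph V ε, T.IsSpanningTree G ∧ (F : Set ε) ⊆ T.edgeSet}
  isRelLowerSet_faces := by
    rintro F ⟨hF, T, hT, hFT⟩
    exact ⟨hF, fun F' hle hF' =>
      ⟨hF', T, hT, (Finset.coe_subset.mpr hle).trans hFT⟩⟩

/-- The set of edges of `G` that join the two vertices of the pair `p`. -/
def bundle (G : Graph V ε) (p : Sym2 G.vertexSet) : Set ε :=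
  {e | ∃ x y : G.vertexSet, p = s(x, y) ∧ G.IsLink e x y}

/-- The multiplicity of the pair `p`: the number of edges of `G` that join its two vertices. -/
noncomputable def mult (G : Graph V ε) (p : Sym2 G.vertexSet) : ℕ := (G.bundle p).ncard

/-- The multiple edges of `G`, each given by its pair of end vertices: the pairs of vertices that
are joined by at least two edges. -/
def multipleEdges (G : Graph V ε) : Set (Sym2 G.vertexSet) := {p | 2 ≤ G.mult p}

/-- The pairs of vertices that are consecutive on some cycle of the associated simple graph. -/
def cyclePairs (G : Graph V ε) : Set (Sym2 G.vertexSet) :=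
  {p | ∃ (v : G.vertexSet) (c : G.toSimpleGraph.Walk v v), c.IsCycle ∧ p ∈ c.edges}

/-- `G` is a uni-cyclic multigraph with `n` edges, `r` multiple edges and a cycle of length `m`:
a connected multigraph without loops with exactly `n` edges, in which exactly `r` pairs of vertices
are joined by more than one edge, and whose associated simple graph has exactly one cycle
(cycles being compared through their edges), the length of which is `m`. -/
structure IsUnicyclicMultigraph (G : Graph V ε) (n r m : ℕ) : Prop where
  loopless : G.Loopless
  connected : G.toSimpleGraph.Connected
  finite : G.edgeSet.Finite
  ncard_edgeSet : G.edgeSet.ncard = n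
  ncard_multipleEdges : G.multipleEdges.ncard = r
  unique_cycle : ∃ (v : G.vertexSet) (c : G.toSimpleGraph.Walk v v), c.IsCycle ∧ c.length = m ∧
    ∀ (w : G.vertexSet) (d : G.toSimpleGraph.Walk w w), d.IsCycle →
      ∀ p : Sym2 G.vertexSet, p ∈ d.edges ↔ p ∈ c.edges

end Graph

namespace PreAbstractSimplicialComplex

variable {ι : Type*}

/-- The dimensions `|F| - 1` of the faces `F` of `K`. -/
def faceDims (K : PreAbstractSimplicialComplex ι) : Set ℤ :=
  {d | ∃ F ∈ K.faces, d = (F.card : ℤ) - 1}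

/-- The dimension of `K`: the largest dimension of a face. -/
noncomputable def dim (K : PreAbstractSimplicialComplex ι) : ℤ := sSup K.faceDims

/-- The face number `f_i`: the number of faces of dimension `i`. -/
noncomputable def faceNumber (K : PreAbstractSimplicialComplex ι) (i : ℕ) : ℕ :=
  {F : Finset ι | F ∈ K.faces ∧ F.card = i + 1}.ncard

/-- The Euler characteristic `∑_{i = 0}^{dim K} (-1)^i f_i`. -/
noncomputable def eulerChar (K : PreAbstractSimplicialComplex ι) : ℤ :=
  ∑ i ∈ Finset.range (K.dim + 1).toNat, (-1) ^ i * (K.faceNumber i : ℤ)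

end PreAbstractSimplicialComplex

namespace SpanningComplexFormula

/-- The binomial coefficient, equal to `0` when the lower index is negative. -/
def binom (a k : ℤ) : ℤ := if 0 ≤ k then Ring.choose a k.toNat else 0

/-- `∑_{i₁ < ... < i_j} t_{i₁} ⋯ t_{i_j}`, over all ways to choose `j` of the indices in `M`. -/
def choiceSum {ι : Type*} (M : Finset ι) (t : ι → ℕ) (j : ℕ) : ℤ :=
  ∑ S ∈ M.powersetCard j, ∏ s ∈ S, (t s : ℤ)

/-- `∑_{j=2}^{p} (C(p,j) - ∑_{i₁<...<i_j} t_{i₁}⋯t_{i_j}) ∑_{l=j}^{p} (-1)^{l-j} C(p-j,l-j) C(N-l,k-l)`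
with `p = ∑_{i ∈ M} t_i`. The subtractions of natural numbers do not truncate, as `j ≤ l ≤ p`. -/
def doubleSum {ι : Type*} (M : Finset ι) (t : ι → ℕ) (N k : ℤ) : ℤ :=
  ∑ j ∈ Finset.Icc 2 (∑ s ∈ M, t s),
    (((∑ s ∈ M, t s).choose j : ℤ) - choiceSum M t j) *
      ∑ l ∈ Finset.Icc j (∑ s ∈ M, t s),
        (-1) ^ (l - j) * (((∑ s ∈ M, t s) - j).choose (l - j) : ℤ) * binom (N - l) (k - l)

open Classical in
/-- The explicit expression for `f_i`, where `M'` and `M''` index the multiple edges within and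
outside the cycle, `t` is the multiplicity, `α = ∑_{s ∈ M'} t s` and `r' = |M'|`. -/
noncomputable def faceFormula {ι : Type*} (n m : ℕ) (M' M'' : Finset ι) (t : ι → ℕ) (i : ℕ) : ℤ :=
  binom n (i + 1)
    - (∏ s ∈ M', (t s : ℤ)) *
        (binom ((n : ℤ) - (∑ s ∈ M', (t s : ℤ)) + M'.card - m) ((i : ℤ) + 1 - m)
          - doubleSum M'' t ((n : ℤ) - (∑ s ∈ M', (t s : ℤ)) + M'.card - m) ((i : ℤ) + 1 - m))
    - doubleSum (M' ∪ M'') t n (i + 1)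

end SpanningComplexFormula

/-! Send each edge to its pair of end vertices. A spanning tree picks one edge over each pair in a
spanning tree of the associated simple graph. As that graph has a single cycle, its spanning trees
arise by deleting one cycle pair. Hence a nonempty edge set is a face iff it has no two parallel
edges and misses some cycle pair (`mem_faces_iff`). Let `Q` be the set of joined pairs, `D` the
cycle pairs and `t` the multiplicity; then `f_i` is the sum of `∏ s ∈ S, t s` over the `S ⊆ Q` with
`|S| = i + 1` and `¬ D ⊆ S`.

Without the last condition the sum is a coefficient of `∏ (1 + t s X)` over `Q`, in which simple
pairs contribute factors `1 + X`; `doubleSum` is the defect of this coefficient from that of `(1 +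
X) ^ n` (`doubleSum_eq_coeff`). The sets `S ⊇ D` contribute `∏ s ∈ D, t s` times the same kind of
coefficient for `Q \ D`. A maximal face has `|Q| - 1` edges, which gives the dimension. -/

namespace SpanningComplexFormula

/-! ### Generating functions for the face formula -/

open Polynomial

lemma coeff_prod_one_add_C_mul_X {ι : Type*} (S : Finset ι) (t : ι → ℕ) (k : ℕ) :
    (∏ s ∈ S, (1 + C (t s : ℤ) * X)).coeff k = choiceSum S t k := by
  classical
  rw [Finset.prod_one_add, finsetSum_coeff, choiceSum, Finset.powersetCard_eq_filter,
    Finset.sum_filter]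
  refine Finset.sum_congr rfl fun U _ => ?_
  rw [Finset.prod_mul_distrib, Finset.prod_const, ← map_prod, coeff_C_mul_X_pow]
  simp only [eq_comm]

/-- The bound on `l` keeps the upper index nonnegative; for `k < l` the convention on negative lower
indices matches the vanishing coefficient. -/
lemma binom_sub_sub {N k l : ℕ} (hl : l ≤ N) :
    binom ((N : ℤ) - l) ((k : ℤ) - l) = (X ^ l * (1 + X) ^ (N - l) : ℤ[X]).coeff k := by
  rw [coeff_X_pow_mul', binom]
  by_cases h : l ≤ k
  · rw [if_pos (by omega), if_pos h, coeff_one_add_X_pow, ← Nat.cast_sub hl, ← Nat.cast_sub h,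
      Int.toNat_natCast, Ring.choose_natCast]
  · rw [if_neg (by omega), if_neg h]

/-- Multiply `X ^ j * (1 + X) ^ (N - p)` by `1 = (-X + (1 + X)) ^ (p - j)` and expand. -/
lemma sum_alternating {j p N : ℕ} (hj : j ≤ p) (hp : p ≤ N) :
    ∑ l ∈ Finset.Icc j p,
      C ((-1 : ℤ) ^ (l - j) * ((p - j).choose (l - j) : ℤ)) * (X ^ l * (1 + X) ^ (N - l))
      = (X ^ j * (1 + X) ^ (N - p) : ℤ[X]) := by
  obtain ⟨a, rfl⟩ := Nat.exists_eq_add_of_le hj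
  obtain ⟨b, rfl⟩ := Nat.exists_eq_add_of_le hp
  have h : ((-X + (1 + X)) ^ a : ℤ[X]) = 1 := by simp
  rw [add_pow] at h
  have hI : Finset.Icc j (j + a) = (Finset.range (a + 1)).map (addLeftEmbedding j) := by
    ext x
    simp only [Finset.mem_Icc, Finset.mem_map, Finset.mem_range, addLeftEmbedding_apply]
    exact ⟨fun h => ⟨x - j, by omega, by omega⟩, by rintro ⟨y, hy, rfl⟩; omega⟩
  rw [hI, Finset.sum_map]
  calc _ = ∑ i ∈ Finset.range (a + 1),
        (X ^ j * (1 + X) ^ b) * ((-X) ^ i * (1 + X) ^ (a - i) * (a.choose i : ℤ[X])) := by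
        refine Finset.sum_congr rfl fun i hi => ?_
        have hi' : i ≤ a := by simpa [Nat.lt_succ_iff] using hi
        simp only [addLeftEmbedding_apply, Nat.add_sub_cancel_left]
        rw [show j + a + b - (j + i) = (a - i) + b by omega, pow_add, pow_add, neg_pow (X : ℤ[X]) i]
        simp only [map_mul, map_pow, map_neg, map_one, map_natCast]
        ring
    _ = _ := by
        rw [← Finset.mul_sum, h, mul_one, Nat.add_sub_cancel_left]

lemma choiceSum_zero {ι : Type*} (M : Finset ι) (t : ι → ℕ) : choiceSum M t 0 = 1 := by
  simp [choiceSum]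

lemma choiceSum_one {ι : Type*} (M : Finset ι) (t : ι → ℕ) :
    choiceSum M t 1 = ((∑ s ∈ M, t s : ℕ) : ℤ) := by
  simp [choiceSum, Finset.powersetCard_one]

/-- Factor out `(1 + X) ^ (N - p)`, expand `(1 + X) ^ p - ∏ (1 + t s X)` in powers of `X`, and
rewrite each term by `sum_alternating`. -/
lemma doubleSum_eq_coeff {ι : Type*} (M : Finset ι) (t : ι → ℕ) (N k : ℕ)
    (hN : ∑ s ∈ M, t s ≤ N) (ht : ∀ s ∈ M, 1 ≤ t s) :
    doubleSum M t N k = ((1 + X) ^ N - (∏ s ∈ M, (1 + C (t s : ℤ) * X))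
      * (1 + X) ^ (N - ∑ s ∈ M, t s) : ℤ[X]).coeff k := by
  set p := ∑ s ∈ M, t s with hp
  have hcard : M.card ≤ p := by
    simpa using Finset.sum_le_sum ht
  have hdeg : (∏ s ∈ M, (1 + C (t s : ℤ) * X)).natDegree < p + 1 := by
    refine Nat.lt_succ_of_le (le_trans (natDegree_prod_le _ _) (le_trans ?_ hcard))
    calc _ ≤ ∑ s ∈ M, 1 := Finset.sum_le_sum fun s _ => by compute_degree
      _ = _ := by simp
  have hprod : (∏ s ∈ M, (1 + C (t s : ℤ) * X))
      = ∑ j ∈ Finset.range (p + 1), C (choiceSum M t j) * X ^ j := by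
    rw [as_sum_range_C_mul_X_pow' _ hdeg]
    simp only [coeff_prod_one_add_C_mul_X]
  have hpow : ((1 + X) ^ p : ℤ[X]) = ∑ j ∈ Finset.range (p + 1), C (p.choose j : ℤ) * X ^ j := by
    rw [add_comm, add_pow]
    refine Finset.sum_congr rfl fun j _ => ?_
    simp [mul_comm]
  have hdiff : ((1 + X) ^ N - (∏ s ∈ M, (1 + C (t s : ℤ) * X)) * (1 + X) ^ (N - p) : ℤ[X])
      = ∑ j ∈ Finset.Icc 2 p, C ((p.choose j : ℤ) - choiceSum M t j)
          * (X ^ j * (1 + X) ^ (N - p)) := by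
    have h1 : ((1 + X) ^ N : ℤ[X]) = (1 + X) ^ p * (1 + X) ^ (N - p) := by
      rw [← pow_add, Nat.add_sub_cancel' hN]
    rw [h1, hprod, hpow, ← sub_mul, ← Finset.sum_sub_distrib, Finset.sum_mul]
    symm
    -- The sum may start at `j = 2`: both constant terms are `1`, and both linear coefficients are
    -- `p = ∑ t s`.
    refine Finset.sum_subset_zero_on_sdiff (fun j hj => ?_) (fun j hj => ?_) (fun j hj => ?_)
    · simp only [Finset.mem_Icc, Finset.mem_range] at hj ⊢; omega
    · simp only [Finset.mem_sdiff, Finset.mem_Icc, Finset.mem_range] at hj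
      have : j = 0 ∨ j = 1 := by omega
      rcases this with rfl | rfl
      · simp [choiceSum_zero]
      · simp [choiceSum_one, hp]
    · simp only [map_sub]; ring
  rw [hdiff, finsetSum_coeff, doubleSum]
  refine Finset.sum_congr rfl fun j hj => ?_
  rw [coeff_C_mul, ← sum_alternating (Finset.mem_Icc.1 hj).2 hN, finsetSum_coeff]
  congr 1
  refine Finset.sum_congr rfl fun l hl => ?_
  rw [coeff_C_mul, binom_sub_sub ((Finset.mem_Icc.1 hl).2.trans hN)]

/-- The number of ways to choose `k` indices of `Q` and one of `t s` objects for each chosen `s`,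
in terms of the indices with at least two objects. -/
lemma choiceSum_eq_binom_sub_doubleSum {ι : Type*} (Q M : Finset ι) (t : ι → ℕ) (N k : ℕ)
    (hQ : ∀ s ∈ Q, 1 ≤ t s) (hM : ∀ s, s ∈ M ↔ s ∈ Q ∧ 2 ≤ t s) (hN : ∑ s ∈ Q, t s = N) :
    choiceSum Q t k = binom N k - doubleSum M t N k := by
  classical
  have hsub : M ⊆ Q := fun s hs => ((hM s).1 hs).1
  have hone : ∀ s ∈ Q \ M, t s = 1 := fun s hs => by
    have h1 := Finset.mem_sdiff.1 hs
    have h2 := hQ s h1.1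
    have h3 := hM s
    by_contra h
    exact h1.2 (h3.2 ⟨h1.1, by omega⟩)
  have hsum := Finset.sum_sdiff (f := t) hsub
  rw [Finset.sum_congr rfl hone, hN] at hsum
  simp only [Finset.sum_const, smul_eq_mul, mul_one] at hsum
  have hb : binom (N : ℤ) (k : ℤ) = ((1 + X) ^ N : ℤ[X]).coeff k := by
    simpa using binom_sub_sub (k := k) (Nat.zero_le N)
  rw [doubleSum_eq_coeff M t N k (by omega) (fun s hs => hQ s (hsub hs)), hb, coeff_sub,
    sub_sub_cancel, ← coeff_prod_one_add_C_mul_X, ← Finset.prod_sdiff hsub]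
  have h1 : ∏ s ∈ Q \ M, (1 + C (t s : ℤ) * X) = ((1 + X) ^ (Q \ M).card : ℤ[X]) := by
    rw [← Finset.prod_const]
    exact Finset.prod_congr rfl fun s hs => by simp [hone s hs]
  rw [h1, show N - ∑ s ∈ M, t s = (Q \ M).card by omega, mul_comm]

lemma binom_of_neg {a k : ℤ} (hk : k < 0) : binom a k = 0 := if_neg (by omega)

lemma doubleSum_of_neg {ι : Type*} (M : Finset ι) (t : ι → ℕ) (N : ℤ) {k : ℤ} (hk : k < 0) :
    doubleSum M t N k = 0 :=
  Finset.sum_eq_zero fun j _ => mul_eq_zero_of_right _ <|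
    Finset.sum_eq_zero fun l _ => mul_eq_zero_of_right _ (binom_of_neg (by omega))

/-- Removing `D` is a bijection onto the subsets of `Q \ D` and splits off the factor over `D`. -/
lemma sum_powersetCard_filter_superset {ι : Type*} [DecidableEq ι] {Q D : Finset ι} (hD : D ⊆ Q)
    (t : ι → ℕ) {k : ℕ} (hk : D.card ≤ k) :
    ∑ S ∈ Q.powersetCard k with D ⊆ S, ∏ s ∈ S, (t s : ℤ)
      = (∏ s ∈ D, (t s : ℤ)) * choiceSum (Q \ D) t (k - D.card) := by
  rw [choiceSum, Finset.mul_sum]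
  refine Finset.sum_nbij' (fun S => S \ D) (fun S => S ∪ D) ?_ ?_ ?_ ?_ ?_
  · intro S hS
    simp only [Finset.mem_filter, Finset.mem_powersetCard] at hS ⊢
    exact ⟨Finset.sdiff_subset_sdiff hS.1.1 le_rfl, by
      rw [Finset.card_sdiff_of_subset hS.2, hS.1.2]⟩
  · intro S hS
    simp only [Finset.mem_filter, Finset.mem_powersetCard] at hS ⊢
    have hdis : Disjoint S D := Finset.disjoint_of_subset_left hS.1 Finset.sdiff_disjoint
    exact ⟨⟨Finset.union_subset (hS.1.trans Finset.sdiff_subset) hD, by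
      rw [Finset.card_union_of_disjoint hdis, hS.2]; omega⟩, Finset.subset_union_right⟩
  · intro S hS
    exact Finset.sdiff_union_of_subset (Finset.mem_filter.1 hS).2
  · intro S hS
    have hdis : Disjoint S D :=
      Finset.disjoint_of_subset_left (Finset.mem_powersetCard.1 hS).1 Finset.sdiff_disjoint
    rw [Finset.union_sdiff_right, Finset.sdiff_eq_self_of_disjoint hdis]
  · intro S hS
    rw [mul_comm, Finset.prod_sdiff (Finset.mem_filter.1 hS).2]

open Classical in
/-- The face formula counts the ways to choose `i + 1` indices of `Q`, not all of `D` among them,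
and one of `t s` objects for each chosen `s`. -/
lemma sum_powersetCard_filter_not_superset {ι : Type*} {Q D M' M'' : Finset ι}
    (hD : D ⊆ Q) (t : ι → ℕ) {n m : ℕ} (i : ℕ) (hQ : ∀ s ∈ Q, 1 ≤ t s)
    (hM' : ∀ s, s ∈ M' ↔ s ∈ D ∧ 2 ≤ t s) (hM'' : ∀ s, s ∈ M'' ↔ (s ∈ Q ∧ s ∉ D) ∧ 2 ≤ t s)
    (hn : ∑ s ∈ Q, t s = n) (hm : D.card = m) :
    ∑ S ∈ Q.powersetCard (i + 1) with ¬ D ⊆ S, ∏ s ∈ S, (t s : ℤ)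
      = faceFormula n m M' M'' t i := by
  have hsub : M' ⊆ D := fun s hs => ((hM' s).1 hs).1
  have hone : ∀ s ∈ D \ M', t s = 1 := fun s hs => by
    have h1 := Finset.mem_sdiff.1 hs
    have h2 := hQ s (hD h1.1)
    by_contra h
    exact h1.2 ((hM' s).2 ⟨h1.1, by omega⟩)
  have hprod : ∏ s ∈ D, (t s : ℤ) = ∏ s ∈ M', (t s : ℤ) :=
    (Finset.prod_subset hsub fun s hs hs' => by
      simp [hone s (Finset.mem_sdiff.2 ⟨hs, hs'⟩)]).symm
  have hs1 := Finset.sum_sdiff (f := t) hsub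
  rw [Finset.sum_congr rfl hone] at hs1
  simp only [Finset.sum_const, smul_eq_mul, mul_one] at hs1
  have hs2 := Finset.sum_sdiff (f := t) hD
  have hs3 := Finset.card_sdiff_add_card_eq_card hsub
  set N' := ∑ s ∈ Q \ D, t s with hN'
  -- The weight of `D` is `∑ s ∈ M', t s` plus `m - |M'|` ones, so the upper index in the formula is
  -- the total weight outside `D`.
  have hNN : (n : ℤ) - (∑ s ∈ M', (t s : ℤ)) + M'.card - m = (N' : ℤ) := by
    rw [← Nat.cast_sum]; omega
  have htot := Finset.sum_filter_add_sum_filter_not (Q.powersetCard (i + 1)) (fun S => D ⊆ S)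
    (fun S => ∏ s ∈ S, (t s : ℤ))
  have hunion := choiceSum_eq_binom_sub_doubleSum Q (M' ∪ M'') t n (i + 1) hQ (fun s => by
    rw [Finset.mem_union, hM', hM'']
    have := @hD s
    tauto) hn
  rw [choiceSum, ← htot] at hunion
  have hcyc : ∑ S ∈ Q.powersetCard (i + 1) with D ⊆ S, ∏ s ∈ S, (t s : ℤ)
      = (∏ s ∈ M', (t s : ℤ)) * (binom N' ((i : ℤ) + 1 - m)
          - doubleSum M'' t N' ((i : ℤ) + 1 - m)) := by
    by_cases hk : D.card ≤ i + 1
    · rw [sum_powersetCard_filter_superset hD t hk, hprod,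
        choiceSum_eq_binom_sub_doubleSum (Q \ D) M'' t N' _
          (fun s hs => hQ s (Finset.mem_sdiff.1 hs).1)
          (fun s => by rw [hM'', Finset.mem_sdiff]) rfl,
        show ((i + 1 - D.card : ℕ) : ℤ) = (i : ℤ) + 1 - m by omega]
    -- Too few indices to cover `D`: the lower indices in the formula are negative.
    · rw [binom_of_neg (by omega), doubleSum_of_neg _ _ _ (by omega), sub_zero, mul_zero]
      refine Finset.sum_eq_zero fun S hS => ?_
      simp only [Finset.mem_filter, Finset.mem_powersetCard] at hS
      have := Finset.card_le_card hS.2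
      omega
  rw [hcyc] at hunion
  rw [faceFormula, hNN]
  push_cast at hunion
  linarith

end SpanningComplexFormula

/-! ### Counting sets on which a map is injective -/

namespace Finset

variable {ε P : Type*}

open scoped Classical in
/-- The transversals of the fibres of `f` over `S`. -/
lemma card_filter_injOn_image_eq (E : Finset ε) (f : ε → P) (S : Finset P) :
    (E.powerset.filter fun F : Finset ε => Set.InjOn f F ∧ F.image f = S).card = ∏ s ∈ S, #{e ∈ E | f e = s} := by
  rw [← Finset.card_pi]
  symm
  refine Finset.card_bij (fun g _ => S.attach.image fun s => g s.1 s.2) ?_ ?_ ?_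
  · intro g hg
    simp only [Finset.mem_pi, Finset.mem_filter] at hg
    simp only [Finset.mem_filter, Finset.mem_powerset]
    refine ⟨?_, ?_, ?_⟩
    · intro e he
      obtain ⟨s, -, rfl⟩ := Finset.mem_image.1 he
      exact (hg s.1 s.2).1
    · intro a ha b hb hab
      obtain ⟨s, -, rfl⟩ := Finset.mem_image.1 (Finset.mem_coe.1 ha)
      obtain ⟨u, -, rfl⟩ := Finset.mem_image.1 (Finset.mem_coe.1 hb)
      rw [(hg s.1 s.2).2, (hg u.1 u.2).2] at hab
      rw [Subtype.ext hab]
    · ext p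
      simp only [Finset.mem_image, Finset.mem_attach, true_and, Subtype.exists]
      constructor
      · rintro ⟨e, ⟨s, hs, rfl⟩, rfl⟩
        rwa [(hg s hs).2]
      · intro hp
        exact ⟨_, ⟨p, hp, rfl⟩, (hg p hp).2⟩
  · intro g hg h hh hgh
    simp only [Finset.mem_pi, Finset.mem_filter] at hg hh
    funext s hs
    have : g s hs ∈ S.attach.image fun s => h s.1 s.2 := by
      refine (Finset.ext_iff.1 hgh _).1 ?_
      exact Finset.mem_image.2 ⟨⟨s, hs⟩, Finset.mem_attach _ _, rfl⟩
    obtain ⟨u, -, hu⟩ := Finset.mem_image.1 this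
    have h1 := (hh u.1 u.2).2
    rw [hu, (hg s hs).2] at h1
    subst h1
    exact hu.symm
  · intro F hF
    simp only [Finset.mem_filter, Finset.mem_powerset] at hF
    obtain ⟨hFE, hinj, rfl⟩ := hF
    have hex : ∀ s ∈ F.image f, ∃ e ∈ F, f e = s := fun s hs => Finset.mem_image.1 hs
    choose g hgF hgf using hex
    refine ⟨g, ?_, ?_⟩
    · simp only [Finset.mem_pi, Finset.mem_filter]
      exact fun s hs => ⟨hFE (hgF s hs), hgf s hs⟩
    · ext e
      simp only [Finset.mem_image, Finset.mem_attach, true_and, Subtype.exists]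
      constructor
      · rintro ⟨s, hs, rfl⟩
        exact hgF s _
      · intro he
        exact ⟨f e, ⟨e, he, rfl⟩, hinj (hgF _ _) he (hgf _ _)⟩

-- Group the sets by their image `S`; those with a given image are the transversals of the fibres
-- over `S`.
open scoped Classical in
lemma card_filter_injOn_image (E : Finset ε) (f : ε → P) (R : Finset P → Prop)
    (k : ℕ) :
    ((E.powersetCard k).filter fun F : Finset ε => Set.InjOn f F ∧ R (F.image f)).card
      = ∑ S ∈ (E.image f).powersetCard k with R S, ∏ s ∈ S, #{e ∈ E | f e = s} := by
  rw [Finset.card_eq_sum_card_fiberwise (f := fun F : Finset ε => F.image f)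
    (t := {S ∈ (E.image f).powersetCard k | R S})]
  · refine Finset.sum_congr rfl fun S hS => ?_
    rw [← card_filter_injOn_image_eq, Finset.filter_filter]
    congr 1
    simp only [Finset.mem_filter, Finset.mem_powersetCard] at hS
    ext F
    simp only [Finset.mem_filter, Finset.mem_powersetCard, Finset.mem_powerset]
    constructor
    · rintro ⟨⟨h1, -⟩, ⟨h2, -⟩, h3⟩
      exact ⟨h1, h2, h3⟩
    · rintro ⟨h1, h2, rfl⟩
      exact ⟨⟨h1, by rw [← Finset.card_image_of_injOn h2]; exact hS.1.2⟩, ⟨h2, hS.2⟩, rfl⟩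
  · intro F hF
    simp only [Finset.coe_filter, Finset.mem_powersetCard, Set.mem_ofPred_eq] at hF ⊢
    exact ⟨⟨Finset.image_subset_image hF.1.1, by rw [Finset.card_image_of_injOn hF.2.1, hF.1.2]⟩,
      hF.2.2⟩

end Finset

/-! ### End pairs of edges and spanning trees -/

namespace Graph

variable {V ε : Type*}

open scoped Classical in
/-- The pair of end vertices of an edge of `G`. -/
noncomputable def ends (G : Graph V ε) [Nonempty G.vertexSet] (e : ε) : Sym2 G.vertexSet :=
  if h : ∃ x y : G.vertexSet, G.IsLink e x y then s(h.choose, h.choose_spec.choose)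
  -- Junk value, taken only off the edge set of `G`.
  else Sym2.diag (Classical.arbitrary _)

section ends

variable (G : Graph V ε) [Nonempty G.vertexSet]

lemma ends_eq_of_isLink {e : ε} {x y : G.vertexSet} (h : G.IsLink e x y) :
    G.ends e = s(x, y) := by
  have hex : ∃ x y : G.vertexSet, G.IsLink e x y := ⟨x, y, h⟩
  rw [ends, dif_pos hex, Sym2.eq_iff, Subtype.ext_iff, Subtype.ext_iff, Subtype.ext_iff,
    Subtype.ext_iff]
  exact hex.choose_spec.choose_spec.eq_and_eq_or_eq_and_eq h

lemma ends_eq_iff {e : ε} (he : e ∈ G.edgeSet) {x y : G.vertexSet} :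
    G.ends e = s(x, y) ↔ G.IsLink e x y := by
  refine ⟨fun h => ?_, G.ends_eq_of_isLink⟩
  obtain ⟨u, v, huv⟩ := G.exists_isLink_of_mem_edgeSet he
  rw [G.ends_eq_of_isLink (x := ⟨u, huv.left_mem⟩) (y := ⟨v, huv.right_mem⟩) huv,
    Sym2.eq_iff, Subtype.ext_iff, Subtype.ext_iff, Subtype.ext_iff, Subtype.ext_iff] at h
  exact huv.isLink_iff.2 h

lemma mem_bundle_iff {e : ε} {p : Sym2 G.vertexSet} :
    e ∈ G.bundle p ↔ e ∈ G.edgeSet ∧ G.ends e = p := by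
  constructor
  · rintro ⟨x, y, rfl, h⟩
    exact ⟨h.edge_mem, G.ends_eq_of_isLink h⟩
  · rintro ⟨he, rfl⟩
    obtain ⟨u, v, huv⟩ := G.exists_isLink_of_mem_edgeSet he
    exact ⟨⟨u, huv.left_mem⟩, ⟨v, huv.right_mem⟩, G.ends_eq_of_isLink huv, huv⟩

/-- The associated simple graph of the spanning subgraph with edge set `X`. -/
lemma toSimpleGraph_restrict {X : Set ε} (hX : X ⊆ G.edgeSet) :
    ((G.restrict X).toSimpleGraph : SimpleGraph G.vertexSet)
      = SimpleGraph.fromEdgeSet (G.ends '' X) := by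
  refine SimpleGraph.ext (funext₂ fun (u v : G.vertexSet) => propext ?_)
  rw [SimpleGraph.fromEdgeSet_adj]
  change (u ≠ v ∧ ∃ e, e ∈ X ∧ G.IsLink e u v) ↔ _
  constructor
  · rintro ⟨hne, e, he, h⟩
    exact ⟨⟨e, he, G.ends_eq_of_isLink h⟩, hne⟩
  · rintro ⟨⟨e, he, h⟩, hne⟩
    exact ⟨hne, e, he, (G.ends_eq_iff (hX he)).1 h⟩

lemma toSimpleGraph_eq_fromEdgeSet :
    G.toSimpleGraph = SimpleGraph.fromEdgeSet (G.ends '' G.edgeSet) := by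
  ext u v
  rw [SimpleGraph.fromEdgeSet_adj]
  constructor
  · rintro ⟨hne, e, h⟩
    exact ⟨⟨e, h.edge_mem, G.ends_eq_of_isLink h⟩, hne⟩
  · rintro ⟨⟨e, he, h⟩, hne⟩
    exact ⟨hne, e, (G.ends_eq_iff he).1 h⟩

lemma edgeSet_toSimpleGraph [G.Loopless] :
    G.toSimpleGraph.edgeSet = G.ends '' G.edgeSet := by
  rw [toSimpleGraph_eq_fromEdgeSet, SimpleGraph.edgeSet_fromEdgeSet, sdiff_eq_left,
    Set.disjoint_left]
  rintro _ ⟨e, he, rfl⟩ hd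
  obtain ⟨u, v, huv⟩ := G.exists_isLink_of_mem_edgeSet he
  rw [G.ends_eq_of_isLink (x := ⟨u, huv.left_mem⟩) (y := ⟨v, huv.right_mem⟩) huv] at hd
  exact huv.ne (congrArg Subtype.val (Sym2.mk_isDiag_iff.1 hd))

/-- In a loopless graph, simplicity of a subgraph only means that no two of its edges are parallel.
-/
lemma isSpanningTree_restrict_iff [hG : G.Loopless] {X : Set ε} (hX : X ⊆ G.edgeSet) :
    (G.restrict X).IsSpanningTree G ↔
      Set.InjOn G.ends X ∧ (SimpleGraph.fromEdgeSet (G.ends '' X)).IsTree := by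
  have hT : (G.restrict X).toSimpleGraph.IsTree ↔
      (SimpleGraph.fromEdgeSet (G.ends '' X)).IsTree := by
    rw [← toSimpleGraph_restrict G hX]
    rfl
  have hsp : (G.restrict X).IsSpanningSubgraph G := ⟨restrict_le, rfl⟩
  rw [IsSpanningTree, IsTree, hT, and_iff_right hsp]
  refine and_congr_left fun _ => ⟨fun hs e he f hf hef => ?_, fun hinj => ?_⟩
  · obtain ⟨u, v, huv⟩ := G.exists_isLink_of_mem_edgeSet (hX he)
    rw [G.ends_eq_of_isLink (x := ⟨u, huv.left_mem⟩) (y := ⟨v, huv.right_mem⟩) huv] at hef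
    exact hs.eq_of_isLink (x := u) (y := v) ⟨he, huv⟩ ⟨hf, (G.ends_eq_iff (hX hf)).1 hef.symm⟩
  · have := Loopless.anti (restrict_le : G.restrict X ≤ G)
    refine { eq_of_isLink := fun e f x y he hf => hinj he.1 hf.1 ?_ }
    rw [G.ends_eq_of_isLink (x := ⟨x, he.2.left_mem⟩) (y := ⟨y, he.2.right_mem⟩) he.2,
      G.ends_eq_of_isLink (x := ⟨x, he.2.left_mem⟩) (y := ⟨y, he.2.right_mem⟩) hf.2]

lemma mem_faces_spanningComplex_iff [G.Loopless] {F : Finset ε} :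
    F ∈ G.spanningComplex.faces ↔ F.Nonempty ∧ ∃ X ⊆ G.edgeSet, (F : Set ε) ⊆ X ∧
      Set.InjOn G.ends X ∧ (SimpleGraph.fromEdgeSet (G.ends '' X)).IsTree := by
  change (F.Nonempty ∧ ∃ T : Graph V ε, T.IsSpanningTree G ∧ (F : Set ε) ⊆ T.edgeSet) ↔ _
  refine and_congr_right fun _ => ⟨?_, ?_⟩
  · rintro ⟨T, hT, hF⟩
    have hX : T.edgeSet ⊆ G.edgeSet := IsSubgraph.edgeSet_mono hT.1.le
    -- A spanning subgraph is determined by its edge set.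
    have hTr : T = G.restrict T.edgeSet :=
      (Compatible.of_le_le hT.1.le restrict_le).ext hT.1.vertexSet_eq
        (Set.inter_eq_right.2 hX).symm
    refine ⟨T.edgeSet, hX, hF, (G.isSpanningTree_restrict_iff hX).1 ?_⟩
    rwa [← hTr]
  · rintro ⟨X, hX, hF, h⟩
    exact ⟨G.restrict X, (G.isSpanningTree_restrict_iff hX).2 h,
      fun e he => ⟨hX (hF he), hF he⟩⟩

open scoped Classical in
lemma mult_eq_card_filter {E : Finset ε} (hE : (E : Set ε) = G.edgeSet) (p : Sym2 G.vertexSet) :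
    G.mult p = (E.filter fun e => G.ends e = p).card := by
  rw [mult, ← Set.ncard_coe_finset]
  congr 1
  ext e
  rw [mem_bundle_iff, ← hE]
  simp

end ends

/-! ### Faces of the spanning complex -/

namespace IsUnicyclicMultigraph

variable {G : Graph V ε} {n r m : ℕ}

lemma nonempty_vertexSet (hG : G.IsUnicyclicMultigraph n r m) : Nonempty G.vertexSet :=
  hG.connected.nonempty

lemma exists_cycle (hG : G.IsUnicyclicMultigraph n r m) :
    ∃ (v : G.vertexSet) (c : G.toSimpleGraph.Walk v v), c.IsCycle ∧ c.length = m ∧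
      G.cyclePairs = {p | p ∈ c.edges} := by
  obtain ⟨v, c, hc, hm, hu⟩ := hG.unique_cycle
  refine ⟨v, c, hc, hm, Set.ext fun p => ⟨?_, fun hp => ⟨v, c, hc, hp⟩⟩⟩
  rintro ⟨w, d, hd, hp⟩
  exact (hu w d hd p).1 hp

lemma ncard_cyclePairs (hG : G.IsUnicyclicMultigraph n r m) :
    G.cyclePairs.ncard = m ∧ 3 ≤ m := by
  classical
  obtain ⟨v, c, hc, hm, hD⟩ := hG.exists_cycle
  have : ({p | p ∈ c.edges} : Set (Sym2 G.vertexSet)) = (c.edges.toFinset : Finset _) := by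
    ext; simp
  rw [hD, this, Set.ncard_coe_finset, List.toFinset_card_of_nodup hc.isTrail.edges_nodup,
    SimpleGraph.Walk.length_edges, hm]
  exact ⟨rfl, hm ▸ hc.three_le_length⟩

lemma cyclePairs_subset [Nonempty G.vertexSet] (hG : G.IsUnicyclicMultigraph n r m) :
    G.cyclePairs ⊆ G.ends '' G.edgeSet := by
  have := hG.loopless
  rintro p ⟨v, c, -, hp⟩
  rw [← edgeSet_toSimpleGraph]
  exact c.edges_subset_edgeSet hp

/-- Removing a pair of the cycle leaves a tree. -/
lemma isTree_fromEdgeSet [Nonempty G.vertexSet] (hG : G.IsUnicyclicMultigraph n r m)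
    {p : Sym2 G.vertexSet} (hp : p ∈ G.cyclePairs) :
    (SimpleGraph.fromEdgeSet (G.ends '' G.edgeSet \ {p})).IsTree := by
  have := hG.loopless
  have hdel : SimpleGraph.fromEdgeSet (G.ends '' G.edgeSet \ {p})
      = G.toSimpleGraph.deleteEdges {p} := by
    rw [SimpleGraph.deleteEdges, ← edgeSet_toSimpleGraph, SimpleGraph.fromEdgeSet_sdiff,
      SimpleGraph.fromEdgeSet_edgeSet]
  rw [hdel]
  -- Connected, since an edge on a cycle is not a bridge; acyclic, since a surviving cycle would
  -- have the edges of the unique cycle, including `p`.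
  refine ⟨?_, fun w d hd => ?_⟩
  · obtain ⟨v, c, hc, hpc⟩ := hp
    induction p with | h a b
    refine hG.connected.connected_delete_edge_of_not_isBridge fun hb => ?_
    exact (SimpleGraph.isBridge_iff_forall_cycle_notMem (c.edges_subset_edgeSet hpc)).1 hb c hc hpc
  · have hle := G.toSimpleGraph.deleteEdges_le {p}
    obtain ⟨v, c, hc, -, hu⟩ := hG.unique_cycle
    obtain ⟨v', c', hc', hpc'⟩ := hp
    have h1 : p ∈ (d.mapLe hle).edges :=
      (hu w _ (hd.mapLe hle) p).2 ((hu v' c' hc' p).1 hpc')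
    rw [SimpleGraph.Walk.edges_mapLe_eq_edges] at h1
    have h2 := d.edges_subset_edgeSet h1
    rw [SimpleGraph.edgeSet_deleteEdges] at h2
    exact h2.2 rfl

/-- The faces of the spanning complex: no two parallel edges, and not all pairs of the cycle. -/
lemma mem_faces_iff [Nonempty G.vertexSet] (hG : G.IsUnicyclicMultigraph n r m) {F : Finset ε} :
    F ∈ G.spanningComplex.faces ↔ F.Nonempty ∧ (F : Set ε) ⊆ G.edgeSet ∧
      Set.InjOn G.ends F ∧ ¬ G.cyclePairs ⊆ G.ends '' F := by
  have := hG.loopless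
  rw [mem_faces_spanningComplex_iff]
  refine and_congr_right fun _ => ⟨?_, ?_⟩
  · rintro ⟨X, hX, hF, hinj, htree⟩
    refine ⟨hF.trans hX, hinj.mono hF, fun hsub => ?_⟩
    obtain ⟨v, c, hc, -, hD⟩ := hG.exists_cycle
    have hmem : ∀ q ∈ c.edges, q ∈ (SimpleGraph.fromEdgeSet (G.ends '' X)).edgeSet := by
      intro q hq
      rw [SimpleGraph.edgeSet_fromEdgeSet]
      exact ⟨Set.image_mono hF (hsub (hD ▸ hq)),
        G.toSimpleGraph.not_isDiag_of_mem_edgeSet (c.edges_subset_edgeSet hq)⟩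
    -- If `F` covers every cycle pair, the whole cycle lies in the tree.
    exact htree.isAcyclic _ (hc.transfer hmem)
  · rintro ⟨hF, hinj, hnot⟩
    obtain ⟨p, hp, hpF⟩ := Set.not_subset.1 hnot
    -- With `p` a cycle pair that `F` misses, `F` extends by one chosen edge over each further pair
    -- other than `p`.
    obtain ⟨X, hFX, hX, hbij⟩ := hinj.bijOn_image.exists_extend_of_subset hF
      (t' := G.ends '' G.edgeSet \ {p})
      (Set.subset_sdiff_singleton (Set.image_mono hF) hpF)
      ((Set.surjOn_image _ _).mono le_rfl Set.sdiff_subset)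
    refine ⟨X, hX, hFX, hbij.injOn, ?_⟩
    rw [hbij.image_eq]
    exact hG.isTree_fromEdgeSet hp

end IsUnicyclicMultigraph

end Graph

/-! ### Face numbers, dimension and Euler characteristic -/

namespace Graph.IsUnicyclicMultigraph

variable {V ε : Type*} {G : Graph V ε} {n r m : ℕ}

open scoped Classical in
lemma one_le_mult [Nonempty G.vertexSet] {E : Finset ε} (hE : (E : Set ε) = G.edgeSet) :
    ∀ p ∈ E.image G.ends, 1 ≤ G.mult p := by
  intro p hp
  obtain ⟨e, he, rfl⟩ := Finset.mem_image.1 hp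
  rw [G.mult_eq_card_filter hE, Nat.one_le_iff_ne_zero, Finset.card_ne_zero]
  exact ⟨e, by simp [he]⟩

open scoped Classical in
lemma mem_image_of_mem_multipleEdges [Nonempty G.vertexSet] {E : Finset ε}
    (hE : (E : Set ε) = G.edgeSet) {p : Sym2 G.vertexSet} (hp : p ∈ G.multipleEdges) :
    p ∈ E.image G.ends := by
  have h : 2 ≤ G.mult p := hp
  rw [G.mult_eq_card_filter hE] at h
  obtain ⟨e, he⟩ := Finset.card_pos.1 (by omega : 0 < (E.filter fun e => G.ends e = p).card)
  exact Finset.mem_image.2 ⟨e, (Finset.mem_filter.1 he).1, (Finset.mem_filter.1 he).2⟩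

/-- The face numbers of the spanning complex of a uni-cyclic multigraph. -/
theorem faceNumber_eq (hG : G.IsUnicyclicMultigraph n r m)
    {M' M'' : Finset (Sym2 G.vertexSet)}
    (hM' : (M' : Set (Sym2 G.vertexSet)) = G.multipleEdges ∩ G.cyclePairs)
    (hM'' : (M'' : Set (Sym2 G.vertexSet)) = G.multipleEdges \ G.cyclePairs) (i : ℕ) :
    (G.spanningComplex.faceNumber i : ℤ)
      = SpanningComplexFormula.faceFormula n m M' M'' G.mult i := by
  classical
  have := hG.nonempty_vertexSet
  set E := hG.finite.toFinset
  have hE : (E : Set ε) = G.edgeSet := hG.finite.coe_toFinset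
  have hDsub : G.cyclePairs ⊆ (E.image G.ends : Finset _) := by
    rw [Finset.coe_image, hE]
    exact hG.cyclePairs_subset
  have hDfin : G.cyclePairs.Finite := (Finset.finite_toSet _).subset hDsub
  set D := hDfin.toFinset
  have hD : (D : Set (Sym2 G.vertexSet)) = G.cyclePairs := hDfin.coe_toFinset
  have hmemM' : ∀ s, s ∈ M' ↔ s ∈ D ∧ 2 ≤ G.mult s := fun s => by
    rw [← Finset.mem_coe, hM', ← hD, and_comm]; rfl
  have hmemM'' : ∀ s, s ∈ M'' ↔ (s ∈ E.image G.ends ∧ s ∉ D) ∧ 2 ≤ G.mult s := fun s => by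
    rw [← Finset.mem_coe, hM'', ← hD]
    exact ⟨fun h => ⟨⟨mem_image_of_mem_multipleEdges hE h.1, h.2⟩, h.1⟩,
      fun h => ⟨h.2, h.1.2⟩⟩
  have hn : ∑ s ∈ E.image G.ends, G.mult s = n := by
    rw [← hG.ncard_edgeSet, ← hE, Set.ncard_coe_finset,
      Finset.card_eq_sum_card_image G.ends E]
    exact Finset.sum_congr rfl fun p _ => G.mult_eq_card_filter hE p
  have hm : D.card = m := by
    rw [← hG.ncard_cyclePairs.1, ← hD, Set.ncard_coe_finset]
  rw [← SpanningComplexFormula.sum_powersetCard_filter_not_superset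
    (by rwa [← Finset.coe_subset, hD]) G.mult i (one_le_mult hE) hmemM' hmemM'' hn hm]
  have hset : {F : Finset ε | F ∈ G.spanningComplex.faces ∧ F.card = i + 1}
      = ((E.powersetCard (i + 1)).filter
          fun F : Finset ε => Set.InjOn G.ends F ∧ ¬ D ⊆ F.image G.ends : Finset (Finset ε)) := by
    ext F
    simp only [Set.mem_ofPred_eq, Finset.coe_filter, Finset.mem_powersetCard, hG.mem_faces_iff]
    rw [← Finset.coe_subset, ← Finset.coe_subset, hE, hD, Finset.coe_image]
    constructor
    · rintro ⟨⟨-, h1, h2⟩, h3⟩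
      exact ⟨⟨h1, h3⟩, h2⟩
    · rintro ⟨⟨h1, h3⟩, h2⟩
      exact ⟨⟨Finset.card_pos.1 (by omega), h1, h2⟩, h3⟩
  rw [PreAbstractSimplicialComplex.faceNumber, hset, Set.ncard_coe_finset]
  have hcount := Finset.card_filter_injOn_image E G.ends (fun S => ¬ D ⊆ S) (i + 1)
  zify at hcount
  simp only [G.mult_eq_card_filter hE]
  convert hcount
  rfl

/-- The number of pairs of vertices that are joined by an edge. -/
lemma ncard_image_ends [Nonempty G.vertexSet] (hG : G.IsUnicyclicMultigraph n r m)
    {M' M'' : Finset (Sym2 G.vertexSet)}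
    (hM' : (M' : Set (Sym2 G.vertexSet)) = G.multipleEdges ∩ G.cyclePairs)
    (hM'' : (M'' : Set (Sym2 G.vertexSet)) = G.multipleEdges \ G.cyclePairs) :
    ((G.ends '' G.edgeSet).ncard : ℤ)
      = n - (∑ p ∈ M', (G.mult p : ℤ)) - (∑ p ∈ M'', (G.mult p : ℤ)) + r := by
  classical
  set E := hG.finite.toFinset
  have hE : (E : Set ε) = G.edgeSet := hG.finite.coe_toFinset
  have hdis : Disjoint M' M'' := by
    rw [← Finset.disjoint_coe, hM', hM'']
    exact Set.disjoint_sdiff_right.mono_left Set.inter_subset_right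
  have hU : ((M' ∪ M'' : Finset _) : Set (Sym2 G.vertexSet)) = G.multipleEdges := by
    rw [Finset.coe_union, hM', hM'', Set.inter_union_sdiff]
  have hr : (M' ∪ M'').card = r := by
    rw [← hG.ncard_multipleEdges, ← hU, Set.ncard_coe_finset]
  have hmem : ∀ p, p ∈ M' ∪ M'' ↔ 2 ≤ G.mult p := fun p => by
    rw [← Finset.mem_coe, hU]; rfl
  have hsub : M' ∪ M'' ⊆ E.image G.ends := fun p hp =>
    mem_image_of_mem_multipleEdges hE ((hmem p).1 hp)
  have hn : ∑ s ∈ E.image G.ends, G.mult s = n := by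
    rw [← hG.ncard_edgeSet, ← hE, Set.ncard_coe_finset,
      Finset.card_eq_sum_card_image G.ends E]
    exact Finset.sum_congr rfl fun p _ => G.mult_eq_card_filter hE p
  have hone : ∀ p ∈ E.image G.ends \ (M' ∪ M''), G.mult p = 1 := fun p hp => by
    rw [Finset.mem_sdiff, hmem] at hp
    have := one_le_mult hE p hp.1
    omega
  have hs := Finset.sum_sdiff (f := G.mult) hsub
  rw [Finset.sum_congr rfl hone, Finset.sum_union hdis, hn] at hs
  -- Each joined pair outside `M' ∪ M''` carries one edge, so `hs` counts these pairs, and adding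
  -- the `r` multiple ones gives the total.
  simp only [Finset.sum_const, smul_eq_mul, mul_one] at hs
  have hc := Finset.card_sdiff_add_card_eq_card hsub
  rw [← hE, ← Finset.coe_image, Set.ncard_coe_finset, ← Nat.cast_sum, ← Nat.cast_sum]
  omega

/-- The maximal faces of the spanning complex use one pair less than `G` does. -/
lemma isGreatest_faceDims [Nonempty G.vertexSet] (hG : G.IsUnicyclicMultigraph n r m) :
    IsGreatest G.spanningComplex.faceDims (((G.ends '' G.edgeSet).ncard : ℤ) - 2) := by
  classical
  have hfin : (G.ends '' G.edgeSet).Finite := hG.finite.image _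
  have hDsub := hG.cyclePairs_subset
  obtain ⟨hm, hm3⟩ := hG.ncard_cyclePairs
  have hle : 3 ≤ (G.ends '' G.edgeSet).ncard := by
    have := Set.ncard_le_ncard hDsub hfin
    omega
  constructor
  · obtain ⟨p, hp⟩ : G.cyclePairs.Nonempty := Set.nonempty_of_ncard_ne_zero (by omega)
    have hsurj : Set.SurjOn G.ends G.edgeSet (G.ends '' G.edgeSet \ {p}) :=
      (Set.surjOn_image _ _).mono le_rfl Set.sdiff_subset
    -- A face of top dimension: one edge over every joined pair except the cycle pair `p`.
    obtain ⟨X, -, hX, hbij⟩ := (Set.bijOn_empty G.ends).exists_extend_of_subset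
      (Set.empty_subset G.edgeSet) (Set.empty_subset _) hsurj
    have hXfin : X.Finite := hG.finite.subset hX
    have hcard : X.ncard = (G.ends '' G.edgeSet).ncard - 1 := by
      rw [← Set.ncard_sdiff_singleton_of_mem (hDsub hp), ← hbij.image_eq,
        hbij.injOn.ncard_image]
    have hcard' : hXfin.toFinset.card = X.ncard := (Set.ncard_eq_toFinset_card X hXfin).symm
    refine ⟨hXfin.toFinset, hG.mem_faces_iff.2 ⟨Finset.card_pos.1 (by omega), ?_⟩, by omega⟩
    rw [hXfin.coe_toFinset, hbij.image_eq]
    exact ⟨hX, hbij.injOn, fun h => (h hp).2 rfl⟩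
  · rintro _ ⟨F, hF, rfl⟩
    obtain ⟨-, hFE, hinj, hnot⟩ := hG.mem_faces_iff.1 hF
    -- Proper, because some cycle pair is missed; this costs one pair, and `|F| - 1` accounts for
    -- the other unit in the `2`.
    have hss : G.ends '' F ⊂ G.ends '' G.edgeSet :=
      ⟨Set.image_mono hFE, fun h => hnot (hDsub.trans h)⟩
    have := Set.ncard_lt_ncard hss hfin
    rw [hinj.ncard_image, Set.ncard_coe_finset] at this
    omega

end Graph.IsUnicyclicMultigraph

lemma PreAbstractSimplicialComplex.faceNumber_eq_zero_of_dim_lt {ι : Type*}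
    {K : PreAbstractSimplicialComplex ι} (hK : IsGreatest K.faceDims K.dim) {i : ℕ}
    (hi : K.dim < i) : K.faceNumber i = 0 := by
  have : {F : Finset ι | F ∈ K.faces ∧ F.card = i + 1} = ∅ := by
    refine Set.eq_empty_of_forall_notMem fun F hF => ?_
    have := hK.2 ⟨F, hF.1, rfl⟩
    rw [hF.2] at this
    omega
  rw [faceNumber, this, Set.ncard_empty]

theorem theorem3p3 {V ε : Type*} (G : Graph V ε) (n r m : ℕ)
    (hG : G.IsUnicyclicMultigraph n r m)
    (M' M'' : Finset (Sym2 G.vertexSet))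
    (hM' : (M' : Set (Sym2 G.vertexSet)) = G.multipleEdges ∩ G.cyclePairs)
    (hM'' : (M'' : Set (Sym2 G.vertexSet)) = G.multipleEdges \ G.cyclePairs) :
    IsGreatest G.spanningComplex.faceDims G.spanningComplex.dim ∧
    G.spanningComplex.dim
      = (n : ℤ) - (∑ p ∈ M', (G.mult p : ℤ)) - (∑ p ∈ M'', (G.mult p : ℤ)) + r - 2 ∧
    (∀ i : ℕ, (G.spanningComplex.faceNumber i : ℤ)
      = SpanningComplexFormula.faceFormula n m M' M'' G.mult i) ∧
    G.spanningComplex.eulerChar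
      = ∑ i ∈ Finset.range n,
          (-1) ^ i * SpanningComplexFormula.faceFormula n m M' M'' G.mult i := by
  have := hG.nonempty_vertexSet
  have hgr := hG.isGreatest_faceDims
  have hdim : G.spanningComplex.dim = ((G.ends '' G.edgeSet).ncard : ℤ) - 2 := hgr.csSup_eq
  have hface := hG.faceNumber_eq hM' hM''
  have hgr' : IsGreatest G.spanningComplex.faceDims G.spanningComplex.dim := hdim ▸ hgr
  refine ⟨hgr', by rw [hdim, hG.ncard_image_ends hM' hM''], hface, ?_⟩
  simp only [← hface]
  have hle : (G.ends '' G.edgeSet).ncard ≤ n := by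
    rw [← hG.ncard_edgeSet]
    exact Set.ncard_image_le hG.finite
  -- Since `dim + 1 ≤ n`, the longer sum only adds face numbers above the dimension, which vanish.
  refine Finset.sum_subset (Finset.range_subset_range.2 (by omega)) fun i _ hi => ?_
  rw [Finset.mem_range] at hi
  rw [PreAbstractSimplicialComplex.faceNumber_eq_zero_of_dim_lt hgr' (by omega), Nat.cast_zero,
    mul_zero]
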